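/- Let $S$ be a semigroup generated by its squares, i.e. every $x\in S$ is a product $x=x_1^2\cdots x_n^2$ with $n\ge 1$ and $x_1,\dots,x_n\in S$. A multiplicative function on $S$ is a map $\chi:S\to\mathbb{C}$ with $\chi(xy)=\chi(x)\chi(y)$ for all $x,y$ (the zero function is allowed); put $I_\chi=\{x\in S:\chi(x)=0\}$. An additive function on a semigroup $T$ is a map $a:T\to\mathbb{C}$ with $a(xy)=a(x)+a(y)$ for all $x,y$. For a multiplicative $\chi\neq 0$ and $\varphi:S\setminus I_\chi\to\mathbb{C}$ let $\Psi_\chi(\varphi):S\to\mathbb{C}$ be the function equal to $\chi(x)\varphi(x)$ for $x\in S\setminus I_\chi$ and to $0$ for $x\in I_\chi$. Let $f,g,h:S\to\mathbb{C}$. Then $$f(xy)=f(x)g(y)+g(x)f(y)+h(x)h(y)\quad\text{for all }x,y\in S$$ with $\{f,h\}$ linearly independent if and only if there are a constant $\delta\in\mathbb{C}$ and functions $F,G,H:S\to\mathbb{C}$ such that $$f=F,\qquad g=-\tfrac12\delta^2F+G+\delta H,\qquad h=-\delta F+H,$$ and $(F,G,H)$ belongs to one of the following families, where $\mu,\chi,\chi_1,\chi_2,\chi_3$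 are multiplicative functions on $S$ such that $\chi\neq0$, $\mu\neq\chi$ and $\chi_1,\chi_2,\chi_3$ are pairwise different, $A,A_1$ are additive functions on $S\setminus I_\chi$ with $A\neq0$, and $c,d,\alpha,\beta\in\mathbb{C}\setminus\{0\}$ are constants: 1. $F=\frac12\Psi_\chi(A_1+A^2)$, $\;G=\chi$, $\;H=\Psi_\chi(A)$. 2. $F=c^2(\mu-\chi)-c\,\Psi_\chi(A)$, $\;G=\chi$, $\;H=c(\mu-\chi)$. 3. $F=c(\mu-\chi)+cd\,\Psi_\chi(A)$, $\;G=\frac{\mu+\chi}{2}-\frac12 d\,\Psi_\chi(A)$, $\;H=\Psi_\chi(A)$, with $1-cd^2=0$. 4. $F=c\beta\chi_1+c(2-\beta)\chi_2-2c\chi_3$, $\;G=\frac14\beta\chi_1+\frac14(2-\beta)\chi_2+\frac12\chi_3$, $\;H=\dfrac{\chi_1-\chi_2}{2\alpha}$, with $2c\alpha^2\beta(2-\beta)=1$. -/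

import Mathlib

namespace CosineSine

/-- A semigroup is generated by its squares if every element is a finite (non-empty) product
`x₁² ⋯ xₙ²`, i.e. if the subsemigroup generated by the squares is everything. -/
def GeneratedBySquares (S : Type*) [Semigroup S] : Prop :=
  Subsemigroup.closure (Set.range fun s : S => s * s) = ⊤

/-- The additive functions `a : T → (ℂ, +)` on a semigroup `T`. -/
def IsAdditive {T : Type*} [Mul T] (a : T → ℂ) : Prop :=
  ∀ x y : T, a (x * y) = a x + a y

/-- The subsemigroup `S \ I_χ` of `S`, where `I_χ = {x | χ x = 0}` and `χ : S → (ℂ, ·)` is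
multiplicative. -/
def nonvanishing {S : Type*} [Semigroup S] (χ : S →ₙ* ℂ) : Subsemigroup S where
  carrier := {x | χ x ≠ 0}
  mul_mem' := by
    intro x y hx hy
    change χ (x * y) ≠ 0
    rw [map_mul]
    exact mul_ne_zero hx hy

open Classical in
/-- `Ψ_χ(φ) = χ φ` on `S \ I_χ`, and `0` on `I_χ`. -/
noncomputable def Psi {S : Type*} [Semigroup S] (χ : S →ₙ* ℂ) (φ : nonvanishing χ → ℂ) :
    S → ℂ :=
  fun x => if hx : x ∈ nonvanishing χ then χ x * φ ⟨x, hx⟩ else 0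

/-- First family. -/
def Family₁ {S : Type*} [Semigroup S] (F G H : S → ℂ) : Prop :=
  ∃ (χ : S →ₙ* ℂ) (A A₁ : nonvanishing χ → ℂ),
    (χ : S → ℂ) ≠ 0 ∧ IsAdditive A ∧ A ≠ 0 ∧ IsAdditive A₁ ∧
    F = (1 / 2 : ℂ) • Psi χ (A₁ + A ^ 2) ∧
    G = χ ∧
    H = Psi χ A

/-- Second family. -/
def Family₂ {S : Type*} [Semigroup S] (F G H : S → ℂ) : Prop :=
  ∃ (μ χ : S →ₙ* ℂ) (A : nonvanishing χ → ℂ) (c : ℂ),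
    (χ : S → ℂ) ≠ 0 ∧ μ ≠ χ ∧ IsAdditive A ∧ A ≠ 0 ∧ c ≠ 0 ∧
    F = c ^ 2 • (⇑μ - ⇑χ) - c • Psi χ A ∧
    G = χ ∧
    H = c • (⇑μ - ⇑χ)

/-- Third family. -/
def Family₃ {S : Type*} [Semigroup S] (F G H : S → ℂ) : Prop :=
  ∃ (μ χ : S →ₙ* ℂ) (A : nonvanishing χ → ℂ) (c d : ℂ),
    (χ : S → ℂ) ≠ 0 ∧ μ ≠ χ ∧ IsAdditive A ∧ A ≠ 0 ∧ c ≠ 0 ∧ d ≠ 0 ∧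
    1 - c * d ^ 2 = 0 ∧
    F = c • (⇑μ - ⇑χ) + (c * d) • Psi χ A ∧
    G = (1 / 2 : ℂ) • (⇑μ + ⇑χ) - (1 / 2 * d) • Psi χ A ∧
    H = Psi χ A

/-- Fourth family. -/
def Family₄ {S : Type*} [Semigroup S] (F G H : S → ℂ) : Prop :=
  ∃ (χ₁ χ₂ χ₃ : S →ₙ* ℂ) (c α β : ℂ),
    χ₁ ≠ χ₂ ∧ χ₁ ≠ χ₃ ∧ χ₂ ≠ χ₃ ∧ c ≠ 0 ∧ α ≠ 0 ∧ β ≠ 0 ∧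
    2 * c * α ^ 2 * β * (2 - β) = 1 ∧
    F = (c * β) • ⇑χ₁ + (c * (2 - β)) • ⇑χ₂ - (2 * c) • ⇑χ₃ ∧
    G = (1 / 4 * β) • ⇑χ₁ + (1 / 4 * (2 - β)) • ⇑χ₂ + (1 / 2 : ℂ) • ⇑χ₃ ∧
    H = (1 / (2 * α)) • (⇑χ₁ - ⇑χ₂)

end CosineSine

namespace CosineSine

variable {S : Type*} [Semigroup S]

/-! ### The functions `Psi χ φ` -/

/-! The right-hand side of the equation polarizes the quadratic form `2fg + h²`. The shifts by `δ`
are isometries of this form fixing `f`, so they preserve solutions; sufficiency is then a direct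
check on the four families.

Conversely, associativity forces `f`, `g`, `h` to satisfy a closed system of addition formulas
(after a shift, if `g` lies in the span of `f` and `h`). This says that `P x = g x + h x X + f x (X²
- sX - r)` is a multiplicative map from `S` into `ℂ[X] / (X³ - sX² - 2rX - q)`. Evaluating `P` at a
root gives a multiplicative function, its derivative at a multiple root gives a derivation over that
function, and `f` is the divided difference of `P` at the three roots. Distinct roots lead to
`Family₄`, a double root to `Family₃`, a triple root to `Family₁`; `Family₂` is not needed, since
the shift can be chosen to reach `Family₃`.

Generation by squares makes these derivations vanish on `I_χ`, so that they can be divided by `χ`.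
-/

theorem Psi_of_ne (χ : S →ₙ* ℂ) (φ : nonvanishing χ → ℂ) {x : S} (hx : χ x ≠ 0) :
    Psi χ φ x = χ x * φ ⟨x, hx⟩ :=
  dif_pos hx

theorem Psi_of_eq_zero (χ : S →ₙ* ℂ) (φ : nonvanishing χ → ℂ) {x : S} (hx : χ x = 0) :
    Psi χ φ x = 0 :=
  dif_neg (fun h => h hx)

theorem Psi_ne_zero {χ : S →ₙ* ℂ} {φ : nonvanishing χ → ℂ} (hφ : φ ≠ 0) : Psi χ φ ≠ 0 := by
  obtain ⟨⟨x, hx⟩, hne⟩ := Function.ne_iff.1 hφ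
  refine Function.ne_iff.2 ⟨x, ?_⟩
  rw [Psi_of_ne χ φ hx]
  exact mul_ne_zero hx hne

theorem Psi_mul {χ : S →ₙ* ℂ} {A : nonvanishing χ → ℂ} (hA : IsAdditive A) (x y : S) :
    Psi χ A (x * y) = Psi χ A x * χ y + χ x * Psi χ A y := by
  by_cases hx : χ x = 0
  · rw [Psi_of_eq_zero χ A hx, Psi_of_eq_zero χ A (x := x * y) (by simp [hx]), hx]
    ring
  by_cases hy : χ y = 0
  · rw [Psi_of_eq_zero χ A hy, Psi_of_eq_zero χ A (x := x * y) (by simp [hy]), hy]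
    ring
  have hxy : χ (x * y) ≠ 0 := by rw [map_mul]; exact mul_ne_zero hx hy
  have : A ⟨x * y, hxy⟩ = A ⟨x, hx⟩ + A ⟨y, hy⟩ := hA ⟨x, hx⟩ ⟨y, hy⟩
  rw [Psi_of_ne χ A hx, Psi_of_ne χ A hy, Psi_of_ne χ A hxy, this, map_mul]
  ring

theorem Psi_add_sq_mul {χ : S →ₙ* ℂ} {A A₁ : nonvanishing χ → ℂ} (hA : IsAdditive A)
    (hA₁ : IsAdditive A₁) (x y : S) :
    Psi χ (A₁ + A ^ 2) (x * y) = Psi χ (A₁ + A ^ 2) x * χ y + χ x * Psi χ (A₁ + A ^ 2) y +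
      2 * (Psi χ A x * Psi χ A y) := by
  by_cases hx : χ x = 0
  · rw [Psi_of_eq_zero χ _ hx, Psi_of_eq_zero χ _ (x := x * y) (by simp [hx]),
      Psi_of_eq_zero χ A hx, hx]
    ring
  by_cases hy : χ y = 0
  · rw [Psi_of_eq_zero χ _ hy, Psi_of_eq_zero χ _ (x := x * y) (by simp [hy]),
      Psi_of_eq_zero χ A hy, hy]
    ring
  have hxy : χ (x * y) ≠ 0 := by rw [map_mul]; exact mul_ne_zero hx hy
  have h : A ⟨x * y, hxy⟩ = A ⟨x, hx⟩ + A ⟨y, hy⟩ := hA ⟨x, hx⟩ ⟨y, hy⟩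
  have h₁ : A₁ ⟨x * y, hxy⟩ = A₁ ⟨x, hx⟩ + A₁ ⟨y, hy⟩ := hA₁ ⟨x, hx⟩ ⟨y, hy⟩
  rw [Psi_of_ne χ _ hx, Psi_of_ne χ _ hy, Psi_of_ne χ _ hxy, Psi_of_ne χ A hx, Psi_of_ne χ A hy]
  simp only [Pi.add_apply, Pi.pow_apply]
  rw [h, h₁, map_mul]
  ring

/-! ### Linear independence of pairs of functions -/

theorem eq_zero_of_smul_fun {X : Type*} {u : ℂ} {φ : X → ℂ} (hφ : φ ≠ 0)
    (h : ∀ x, u * φ x = 0) : u = 0 := by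
  obtain ⟨x, hx⟩ := Function.ne_iff.1 hφ
  exact (mul_eq_zero.1 (h x)).resolve_right hx

theorem coe_sub_ne_zero {μ χ : S →ₙ* ℂ} (h : μ ≠ χ) : (⇑μ - ⇑χ : S → ℂ) ≠ 0 :=
  fun h0 => h (DFunLike.coe_injective (sub_eq_zero.1 h0))

theorem linearIndependent_pair_fun {X : Type*} {f h : X → ℂ}
    (H : ∀ u v : ℂ, (∀ x, u * f x + v * h x = 0) → u = 0 ∧ v = 0) :
    LinearIndependent ℂ ![f, h] :=
  LinearIndependent.pair_iff.2 fun u v huv => H u v fun x => by simpa using congrFun huv x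

theorem pair_fun_coeff_eq_zero {X : Type*} {f h : X → ℂ} (hfh : LinearIndependent ℂ ![f, h])
    {u v : ℂ} (huv : ∀ x, u * f x + v * h x = 0) : u = 0 ∧ v = 0 :=
  LinearIndependent.pair_iff.1 hfh u v (funext fun x => by simpa using huv x)

/-- Differences of three distinct multiplicative functions, one of which may vanish, are linearly
independent. -/
theorem coeff_eq_zero_of_three {χ₁ χ₂ χ₃ : S →ₙ* ℂ} (h₁₂ : χ₁ ≠ χ₂) (h₁₃ : χ₁ ≠ χ₃)
    (h₂₃ : χ₂ ≠ χ₃) {u v : ℂ}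
    (h : ∀ x, u * (χ₁ x - χ₃ x) + v * (χ₂ x - χ₃ x) = 0) : u = 0 ∧ v = 0 := by
  have hu : u = 0 := by
    -- The combination of the relation at `x * y`, `x` and `y` below leaves only `u (χ₁ - χ₂)(x) (χ₁
    -- - χ₃)(y)`.
    refine eq_zero_of_smul_fun (coe_sub_ne_zero h₁₃) fun y => ?_
    refine eq_zero_of_smul_fun (coe_sub_ne_zero h₁₂) fun x => ?_
    have hxy := h (x * y)
    simp only [map_mul] at hxy
    simp only [Pi.sub_apply]
    linear_combination hxy - χ₃ y * h x - χ₂ x * h y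
  refine ⟨hu, eq_zero_of_smul_fun (coe_sub_ne_zero h₂₃) fun x => ?_⟩
  have := h x
  rw [hu] at this
  simpa using this

/-- The operator `φ(xy) - φ(x)χ(y) - χ(x)φ(y)` kills the derivation `ψ` and sends `μ - χ` to `(μ -
χ)(x) (μ - χ)(y)`. -/
theorem coeff_eq_zero_of_derivation {μ χ : S →ₙ* ℂ} (hμ : μ ≠ χ) {ψ : S → ℂ} (hψ0 : ψ ≠ 0)
    (hψ : ∀ x y, ψ (x * y) = ψ x * χ y + χ x * ψ y) {u v : ℂ}
    (h : ∀ x, u * (μ x - χ x) + v * ψ x = 0) : u = 0 ∧ v = 0 := by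
  have hu : u = 0 := by
    refine eq_zero_of_smul_fun (coe_sub_ne_zero hμ) fun y => ?_
    refine eq_zero_of_smul_fun (coe_sub_ne_zero hμ) fun x => ?_
    have hxy := h (x * y)
    simp only [map_mul, hψ] at hxy
    simp only [Pi.sub_apply]
    linear_combination hxy - χ y * h x - χ x * h y
  refine ⟨hu, eq_zero_of_smul_fun hψ0 fun x => ?_⟩
  have := h x
  rw [hu] at this
  simpa using this

/-! ### The four families are solutions -/

/-- `(f, g, h)` solves the cosine-sine functional equation. -/
def IsSolution (f g h : S → ℂ) : Prop :=
  ∀ x y : S, f (x * y) = f x * g y + g x * f y + h x * h y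

theorem Family₁.isSolution {F G H : S → ℂ} (hF : Family₁ F G H) :
    IsSolution F G H ∧ LinearIndependent ℂ ![F, H] := by
  obtain ⟨χ, A, A₁, -, hA, hA0, hA₁, rfl, rfl, rfl⟩ := hF
  have key : IsSolution ((1 / 2 : ℂ) • Psi χ (A₁ + A ^ 2)) χ (Psi χ A) := fun x y => by
    simp only [Pi.smul_apply, smul_eq_mul, Psi_add_sq_mul hA hA₁]
    ring
  refine ⟨key, linearIndependent_pair_fun fun u v huv => ?_⟩
  have hu : u = 0 := by
    -- The defect of `F` from being a derivation over `χ` is `H x * H y`, while `H` has none.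
    refine eq_zero_of_smul_fun (Psi_ne_zero hA0) fun y => ?_
    refine eq_zero_of_smul_fun (Psi_ne_zero hA0) fun x => ?_
    have hxy := huv (x * y)
    rw [key x y, Psi_mul hA] at hxy
    linear_combination hxy - χ y * huv x - χ x * huv y
  refine ⟨hu, eq_zero_of_smul_fun (Psi_ne_zero hA0) fun x => ?_⟩
  have := huv x
  rw [hu] at this
  simpa using this

theorem Family₂.isSolution {F G H : S → ℂ} (hF : Family₂ F G H) :
    IsSolution F G H ∧ LinearIndependent ℂ ![F, H] := by
  obtain ⟨μ, χ, A, c, -, hμ, hA, hA0, hc, rfl, rfl, rfl⟩ := hF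
  refine ⟨fun x y => ?_, linearIndependent_pair_fun fun u v huv => ?_⟩
  · simp only [Pi.smul_apply, Pi.sub_apply, smul_eq_mul, Psi_mul hA, map_mul]
    ring
  · simp only [Pi.smul_apply, Pi.sub_apply, smul_eq_mul] at huv
    obtain ⟨h₁, h₂⟩ := coeff_eq_zero_of_derivation hμ (Psi_ne_zero hA0) (Psi_mul hA)
      (u := u * c ^ 2 + v * c) (v := -(u * c)) fun x => by linear_combination huv x
    have hu : u = 0 := by simpa [hc] using h₂
    rw [hu] at h₁
    exact ⟨hu, by simpa [hc] using h₁⟩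

theorem Family₃.isSolution {F G H : S → ℂ} (hF : Family₃ F G H) :
    IsSolution F G H ∧ LinearIndependent ℂ ![F, H] := by
  obtain ⟨μ, χ, A, c, d, -, hμ, hA, hA0, hc, hd, hcd, rfl, rfl, rfl⟩ := hF
  refine ⟨fun x y => ?_, linearIndependent_pair_fun fun u v huv => ?_⟩
  · simp only [Pi.smul_apply, Pi.sub_apply, Pi.add_apply, smul_eq_mul, Psi_mul hA, map_mul]
    linear_combination -(Psi χ A x * Psi χ A y) * hcd
  · simp only [Pi.smul_apply, Pi.sub_apply, Pi.add_apply, smul_eq_mul] at huv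
    obtain ⟨h₁, h₂⟩ := coeff_eq_zero_of_derivation hμ (Psi_ne_zero hA0) (Psi_mul hA)
      (u := u * c) (v := u * (c * d) + v) fun x => by linear_combination huv x
    have hu : u = 0 := by simpa [hc] using h₁
    rw [hu] at h₂
    exact ⟨hu, by simpa using h₂⟩

theorem Family₄.isSolution {F G H : S → ℂ} (hF : Family₄ F G H) :
    IsSolution F G H ∧ LinearIndependent ℂ ![F, H] := by
  obtain ⟨χ₁, χ₂, χ₃, c, α, β, h₁₂, h₁₃, h₂₃, hc, hα, hβ, hrel, rfl, rfl, rfl⟩ := hF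
  refine ⟨fun x y => ?_, linearIndependent_pair_fun fun u v huv => ?_⟩
  · simp only [Pi.smul_apply, Pi.sub_apply, Pi.add_apply, smul_eq_mul, map_mul]
    have hq : (1 / (2 * α)) ^ 2 = c * β * (2 - β) / 2 := by
      field_simp
      linear_combination -hrel
    linear_combination -((χ₁ x - χ₂ x) * (χ₁ y - χ₂ y)) * hq
  · simp only [Pi.smul_apply, Pi.sub_apply, Pi.add_apply, smul_eq_mul] at huv
    obtain ⟨h₁, h₂⟩ := coeff_eq_zero_of_three h₁₂ h₁₃ h₂₃
      (u := u * (c * β) + v * (1 / (2 * α))) (v := u * (c * (2 - β)) - v * (1 / (2 * α)))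
      fun x => by linear_combination huv x
    have hu : u = 0 := by
      have : u * (2 * c) = 0 := by linear_combination h₁ + h₂
      simpa [hc] using this
    rw [hu] at h₁
    exact ⟨hu, by simpa [hα] using h₁⟩

/-! ### Shifting a solution -/

theorem isSolution_shift {F G H : S → ℂ} (hF : IsSolution F G H) (δ : ℂ) :
    IsSolution F (-((1 / 2 : ℂ) * δ ^ 2) • F + G + δ • H) (-(δ • F) + H) := fun x y => by
  simp only [Pi.smul_apply, Pi.neg_apply, Pi.add_apply, smul_eq_mul]
  rw [hF x y]
  ring

theorem linearIndependent_shift {X : Type*} {F H : X → ℂ}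
    (hF : LinearIndependent ℂ ![F, H]) (δ : ℂ) :
    LinearIndependent ℂ ![F, -(δ • F) + H] := by
  refine linearIndependent_pair_fun fun u v huv => ?_
  simp only [Pi.smul_apply, Pi.neg_apply, Pi.add_apply, smul_eq_mul] at huv
  obtain ⟨h₁, h₂⟩ := pair_fun_coeff_eq_zero hF (u := u - v * δ) (v := v)
    fun x => by linear_combination huv x
  rw [h₂] at h₁
  exact ⟨by simpa using h₁, h₂⟩

/-- `(f, g, h)` is a shift of a member of one of the four families. -/
def IsShiftOfFamily (f g h : S → ℂ) : Prop :=
  ∃ (δ : ℂ) (F G H : S → ℂ),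
    (Family₁ F G H ∨ Family₂ F G H ∨ Family₃ F G H ∨ Family₄ F G H) ∧
    f = F ∧
    g = -((1 / 2 : ℂ) * δ ^ 2) • F + G + δ • H ∧
    h = -(δ • F) + H

/-- Shifts form a one-parameter group, so the shift by `δ` can be undone. -/
theorem IsShiftOfFamily.of_shift {f g h : S → ℂ} (δ : ℂ)
    (H : IsShiftOfFamily f (-((1 / 2 : ℂ) * δ ^ 2) • f + g + δ • h) (-(δ • f) + h)) :
    IsShiftOfFamily f g h := by
  obtain ⟨ε, F, G, H, hfam, rfl, hG, hH⟩ := H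
  refine ⟨ε - δ, f, G, H, hfam, rfl, ?_, ?_⟩
  · funext x
    have h₁ := congrFun hG x
    have h₂ := congrFun hH x
    simp only [Pi.smul_apply, Pi.neg_apply, Pi.add_apply, smul_eq_mul] at h₁ h₂ ⊢
    linear_combination h₁ - δ * h₂
  · funext x
    have h₂ := congrFun hH x
    simp only [Pi.smul_apply, Pi.neg_apply, Pi.add_apply, smul_eq_mul] at h₂ ⊢
    linear_combination h₂

/-! ### Functions vanishing with a multiplicative function -/

/-- If `χ y = 0`, then `φ (y * y) = ψ y ^ 2 = 0`; in a product where `χ` vanishes, it vanishes at a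
factor, and so do `ψ` and, inductively, `φ`. Taking `ψ = 0` covers derivations. -/
theorem eq_zero_of_generatedBySquares (hS : GeneratedBySquares S) {χ : S →ₙ* ℂ} {φ ψ : S → ℂ}
    (hψ : ∀ x, χ x = 0 → ψ x = 0)
    (hφ : ∀ x y, φ (x * y) = φ x * χ y + χ x * φ y + ψ x * ψ y) (x : S) (hx : χ x = 0) :
    φ x = 0 := by
  have hmem : x ∈ Subsemigroup.closure (Set.range fun s : S => s * s) := by
    rw [show Subsemigroup.closure (Set.range fun s : S => s * s) = ⊤ from hS]
    trivial
  induction hmem using Subsemigroup.closure_induction with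
  | mem z hz =>
    obtain ⟨y, rfl⟩ := hz
    have hy : χ y = 0 := by simpa using hx
    simp [hφ, hy, hψ y hy]
  | mul y z _ _ ihy ihz =>
    rw [map_mul, mul_eq_zero] at hx
    rcases hx with h | h
    · simp [hφ, h, ihy h, hψ y h]
    · simp [hφ, h, ihz h, hψ z h]

theorem exists_eq_Psi {χ : S →ₙ* ℂ} {φ : S → ℂ} (hφ : ∀ x, χ x = 0 → φ x = 0) :
    φ = Psi χ fun x => φ x / χ x := by
  funext x
  by_cases hx : χ x = 0
  · rw [hφ x hx, Psi_of_eq_zero χ _ hx]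
  · rw [Psi_of_ne χ _ hx]
    field_simp

/-- A nonzero solution of the sine addition formula for `χ` is `Psi χ A` with `A` additive. -/
theorem exists_additive (hS : GeneratedBySquares S) {χ : S →ₙ* ℂ} {ψ : S → ℂ} (hψ0 : ψ ≠ 0)
    (hψ : ∀ x y, ψ (x * y) = ψ x * χ y + χ x * ψ y) :
    (χ : S → ℂ) ≠ 0 ∧ (∀ x, χ x = 0 → ψ x = 0) ∧
      ∃ A : nonvanishing χ → ℂ, IsAdditive A ∧ A ≠ 0 ∧ ψ = Psi χ A := by
  have hv : ∀ x, χ x = 0 → ψ x = 0 :=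
    eq_zero_of_generatedBySquares hS (ψ := 0) (fun _ _ => rfl) fun x y => by simp [hψ]
  have heq := exists_eq_Psi hv
  refine ⟨fun h0 => hψ0 (funext fun x => hv x (congrFun h0 x)), hv, _, ?_, ?_, heq⟩
  · rintro ⟨x, hx : χ x ≠ 0⟩ ⟨y, hy : χ y ≠ 0⟩
    change ψ (x * y) / χ (x * y) = ψ x / χ x + ψ y / χ y
    rw [hψ, map_mul]
    field_simp
  · intro h0
    apply hψ0
    rw [heq, h0]
    funext x
    by_cases hx : χ x = 0
    · rw [Psi_of_eq_zero χ _ hx]; rfl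
    · rw [Psi_of_ne χ _ hx]; simp

/-! ### Closed systems -/

/-- The addition formulas for `f`, `g`, `h` dual to the multiplication of
`ℂ[X] / (X³ - s X² - 2 r X - q)`. -/
structure IsClosedSystem (q r s : ℂ) (f g h : S → ℂ) : Prop where
  f_mul : ∀ x y, f (x * y) = f x * g y + g x * f y + h x * h y
  g_mul : ∀ x y, g (x * y) =
    g x * g y + (r ^ 2 - q * s) * (f x * f y) + q * (f x * h y + h x * f y) + r * (h x * h y)
  h_mul : ∀ x y, h (x * y) =
    g x * h y + h x * g y + q * (f x * f y) + r * (f x * h y + h x * f y) + s * (h x * h y)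

theorem exists_roots (q r s : ℂ) :
    ∃ a b c : ℂ, s = a + b + c ∧ r = -(a * b + b * c + c * a) / 2 ∧ q = a * b * c := by
  obtain ⟨a, ha⟩ : ∃ a : ℂ, a ^ 3 - s * a ^ 2 - 2 * r * a - q = 0 := by
    obtain ⟨a, ha⟩ := IsAlgClosed.exists_root
      (Polynomial.X ^ 3 + (-(Polynomial.C s * Polynomial.X ^ 2) -
        Polynomial.C (2 * r) * Polynomial.X - Polynomial.C q) : Polynomial ℂ) (by
        rw [show (Polynomial.X ^ 3 + (-(Polynomial.C s * Polynomial.X ^ 2) -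
          Polynomial.C (2 * r) * Polynomial.X - Polynomial.C q) : Polynomial ℂ).degree = 3 by
            compute_degree!]
        decide)
    refine ⟨a, ?_⟩
    simp only [Polynomial.IsRoot.def, Polynomial.eval_add, Polynomial.eval_sub, Polynomial.eval_neg,
      Polynomial.eval_mul, Polynomial.eval_pow, Polynomial.eval_X, Polynomial.eval_C] at ha
    linear_combination ha
  -- `d` is a square root of the discriminant of the quadratic cofactor of `X - a`.
  obtain ⟨d, hd⟩ := IsAlgClosed.exists_pow_nat_eq
    ((s - a) ^ 2 - 4 * (a ^ 2 - s * a - 2 * r)) (n := 2) (by norm_num)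
  refine ⟨a, (s - a + d) / 2, (s - a - d) / 2, by ring, ?_, ?_⟩
  · linear_combination -hd / 8
  · linear_combination -ha + a / 4 * hd

namespace IsClosedSystem

variable {q r s : ℂ} {f g h : S → ℂ}

/-- The multiplicative function belonging to the root `l`. -/
def char (hsys : IsClosedSystem q r s f g h) (l : ℂ) (hl : l ^ 3 = s * l ^ 2 + 2 * r * l + q) :
    S →ₙ* ℂ where
  toFun x := (l ^ 2 - s * l - r) * f x + g x + l * h x
  map_mul' x y := by
    rw [hsys.f_mul, hsys.g_mul, hsys.h_mul]
    linear_combination ((-l + s) * (f x * f y) - (f x * h y + h x * f y)) * hl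

theorem char_apply (hsys : IsClosedSystem q r s f g h) (l : ℂ)
    (hl : l ^ 3 = s * l ^ 2 + 2 * r * l + q) (x : S) :
    hsys.char l hl x = (l ^ 2 - s * l - r) * f x + g x + l * h x :=
  rfl

theorem char_ne (hsys : IsClosedSystem q r s f g h) (hfh : LinearIndependent ℂ ![f, h]) {l m : ℂ}
    (hl : l ^ 3 = s * l ^ 2 + 2 * r * l + q) (hm : m ^ 3 = s * m ^ 2 + 2 * r * m + q)
    (hlm : l ≠ m) : hsys.char l hl ≠ hsys.char m hm := fun heq => by
  have := pair_fun_coeff_eq_zero hfh (u := (l - m) * (l + m - s)) (v := l - m) fun x => by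
    have := DFunLike.congr_fun heq x
    rw [char_apply, char_apply] at this
    linear_combination this
  exact hlm (sub_eq_zero.1 this.2)

theorem isShiftOfFamily_of_distinct {a b c : ℂ}
    (hsys : IsClosedSystem (a * b * c) (-(a * b + b * c + c * a) / 2) (a + b + c) f g h)
    (hfh : LinearIndependent ℂ ![f, h]) (hab : a ≠ b) (hac : a ≠ c) (hbc : b ≠ c) :
    IsShiftOfFamily f g h := by
  have ha : a ^ 3 = (a + b + c) * a ^ 2 + 2 * (-(a * b + b * c + c * a) / 2) * a + a * b * c := by
    ring
  have hb : b ^ 3 = (a + b + c) * b ^ 2 + 2 * (-(a * b + b * c + c * a) / 2) * b + a * b * c := by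
    ring
  have hc : c ^ 3 = (a + b + c) * c ^ 2 + 2 * (-(a * b + b * c + c * a) / 2) * c + a * b * c := by
    ring
  have hab' := sub_ne_zero.2 hab
  have hac' := sub_ne_zero.2 hac
  have hbc' := sub_ne_zero.2 hbc
  -- Here `h - c f` is the divided difference of `P` at `a, b`, namely `(χ₁ - χ₂) / (a - b)`, and
  -- `f` the one at `a, b, c`; the constants are read off from these.
  refine ⟨-c, _, _, _, Or.inr (Or.inr (Or.inr ⟨hsys.char a ha, hsys.char b hb, hsys.char c hc,
    -(1 / (2 * (a - c) * (b - c))), (a - b) / 2, -(2 * (b - c) / (a - b)),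
    hsys.char_ne hfh _ _ hab, hsys.char_ne hfh _ _ hac, hsys.char_ne hfh _ _ hbc,
    ?_, ?_, ?_, ?_, rfl, rfl, rfl⟩)), ?_, ?_, ?_⟩
  · simp [hac', hbc']
  · simp [hab']
  · simp [hab', hbc']
  · field_simp
    ring
  all_goals
    funext x
    simp only [Pi.smul_apply, Pi.neg_apply, Pi.sub_apply, Pi.add_apply, smul_eq_mul, char_apply]
    field_simp
    ring

/-- `h - c f` is the derivative of `P` at the double root `a`, because `2a - s = -c`. -/
theorem derivation_mul {a c : ℂ}
    (hsys : IsClosedSystem (a * a * c) (-(a * a + a * c + c * a) / 2) (a + a + c) f g h)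
    (ha : a ^ 3 = (a + a + c) * a ^ 2 + 2 * (-(a * a + a * c + c * a) / 2) * a + a * a * c)
    (x y : S) : (h - c • f) (x * y) =
      (h - c • f) x * hsys.char a ha y + hsys.char a ha x * (h - c • f) y := by
  simp only [Pi.sub_apply, Pi.smul_apply, smul_eq_mul, char_apply, hsys.f_mul, hsys.h_mul]
  ring

theorem sub_smul_ne_zero {X : Type*} {f h : X → ℂ} (hfh : LinearIndependent ℂ ![f, h]) (c : ℂ) :
    h - c • f ≠ 0 :=
  fun h0 => one_ne_zero (pair_fun_coeff_eq_zero hfh (u := -c) (v := 1) fun x => by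
    have := congrFun h0 x
    simp only [Pi.sub_apply, Pi.smul_apply, smul_eq_mul, Pi.zero_apply] at this
    linear_combination this).2

theorem isShiftOfFamily_of_double (hS : GeneratedBySquares S) {a c : ℂ}
    (hsys : IsClosedSystem (a * a * c) (-(a * a + a * c + c * a) / 2) (a + a + c) f g h)
    (hfh : LinearIndependent ℂ ![f, h]) (hac : a ≠ c) :
    IsShiftOfFamily f g h := by
  have ha : a ^ 3 = (a + a + c) * a ^ 2 + 2 * (-(a * a + a * c + c * a) / 2) * a + a * a * c := by
    ring
  have hc : c ^ 3 = (a + a + c) * c ^ 2 + 2 * (-(a * a + a * c + c * a) / 2) * c + a * a * c := by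
    ring
  have hac' := sub_ne_zero.2 hac
  obtain ⟨hχ, -, A, hA, hA0, hψ⟩ :=
    exists_additive hS (sub_smul_ne_zero hfh c) (hsys.derivation_mul ha)
  refine ⟨-c, _, _, _, Or.inr (Or.inr (Or.inl ⟨hsys.char c hc, hsys.char a ha, A,
    1 / (a - c) ^ 2, a - c, hχ, hsys.char_ne hfh _ _ hac.symm, hA, hA0,
    ?_, hac', ?_, rfl, rfl, rfl⟩)), ?_, ?_, ?_⟩
  · simp [hac']
  · field_simp
    ring
  all_goals
    rw [← hψ]
    funext x
    simp only [Pi.smul_apply, Pi.neg_apply, Pi.sub_apply, Pi.add_apply, smul_eq_mul, char_apply]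
    field_simp
    ring

theorem isShiftOfFamily_of_triple (hS : GeneratedBySquares S) {a : ℂ}
    (hsys : IsClosedSystem (a * a * a) (-(a * a + a * a + a * a) / 2) (a + a + a) f g h)
    (hfh : LinearIndependent ℂ ![f, h]) :
    IsShiftOfFamily f g h := by
  have ha : a ^ 3 = (a + a + a) * a ^ 2 + 2 * (-(a * a + a * a + a * a) / 2) * a + a * a * a := by
    ring
  have hder := hsys.derivation_mul ha
  obtain ⟨χ, hχdef⟩ : ∃ χ, χ = hsys.char a ha := ⟨_, rfl⟩
  rw [← hχdef] at hder
  obtain ⟨hχ, hv, A, hA, hA0, hψ⟩ := exists_additive hS (sub_smul_ne_zero hfh a) hder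
  have hf : ∀ x y, f (x * y) = f x * χ y + χ x * f y + (h - a • f) x * (h - a • f) y := by
    intro x y
    simp only [hχdef, Pi.sub_apply, Pi.smul_apply, smul_eq_mul, char_apply, hsys.f_mul]
    ring
  have hfv := eq_zero_of_generatedBySquares hS hv hf
  have hAval : ∀ x : nonvanishing χ, (h - a • f) x = χ x * A x := fun x => by
    rw [hψ]; exact Psi_of_ne χ A x.2
  -- `A₁` is solved for from the desired formula; the cross term of `A ^ 2` cancels the product term
  -- in `hf`, which makes it additive.
  have hfF : f = (1 / 2 : ℂ) • Psi χ ((fun x : nonvanishing χ => 2 * (f x / χ x) - A x ^ 2) +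
      A ^ 2) := by
    funext x
    by_cases hx : χ x = 0
    · simp [hfv x hx, Psi_of_eq_zero χ _ hx]
    · simp only [Pi.smul_apply, smul_eq_mul, Psi_of_ne χ _ hx, Pi.add_apply, Pi.pow_apply]
      field_simp
      ring
  refine ⟨-a, _, _, _, Or.inl ⟨χ, A, fun x => 2 * (f x / χ x) - A x ^ 2, hχ, hA, hA0,
    ?_, rfl, rfl, rfl⟩, hfF, ?_, ?_⟩
  · intro x y
    have hx : χ x ≠ 0 := x.2
    have hy : χ y ≠ 0 := y.2
    change 2 * (f (x * y) / χ (x * y)) - A (x * y) ^ 2 = _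
    rw [hA x y, hf, map_mul, hAval, hAval]
    field_simp
    ring
  all_goals
    rw [← hψ, ← hfF]
    funext x
    simp only [hχdef, Pi.smul_apply, Pi.neg_apply, Pi.sub_apply, Pi.add_apply, smul_eq_mul,
      char_apply]
    ring

theorem isShiftOfFamily (hS : GeneratedBySquares S) (hsys : IsClosedSystem q r s f g h)
    (hfh : LinearIndependent ℂ ![f, h]) : IsShiftOfFamily f g h := by
  obtain ⟨a, b, c, rfl, rfl, rfl⟩ := exists_roots q r s
  -- The coefficients are symmetric in the roots, so a repeated root can be moved to the first two
  -- places.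
  have rotate : ∀ {a b c : ℂ},
      IsClosedSystem (a * b * c) (-(a * b + b * c + c * a) / 2) (a + b + c) f g h →
      IsClosedSystem (b * c * a) (-(b * c + c * a + a * b) / 2) (b + c + a) f g h := by
    intro a b c H
    convert H using 1 <;> ring
  by_cases hab : a = b
  · subst hab
    by_cases hac : a = c
    · subst hac
      exact isShiftOfFamily_of_triple hS hsys hfh
    · exact isShiftOfFamily_of_double hS hsys hfh hac
  by_cases hbc : b = c
  · subst hbc
    exact isShiftOfFamily_of_double hS (rotate hsys) hfh (Ne.symm hab)
  by_cases hac : a = c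
  · subst hac
    exact isShiftOfFamily_of_double hS (rotate (rotate hsys)) hfh hab
  · exact isShiftOfFamily_of_distinct hsys hfh hab hac hbc

end IsClosedSystem

/-! ### Every solution belongs to a closed system -/

/-- Applied to identities with all variables but one frozen, such a functional extracts the
coefficient of one function. -/
theorem exists_dual_functional {ι V : Type*} [AddCommGroup V] [Module ℂ V] {v : ι → V}
    (hv : LinearIndependent ℂ v) (i : ι) :
    ∃ l : V →ₗ[ℂ] ℂ, l (v i) = 1 ∧ ∀ j, j ≠ i → l (v j) = 0 := by
  classical
  obtain ⟨l, hl⟩ := LinearMap.exists_extend ((Finsupp.lapply i).comp hv.repr : _ →ₗ[ℂ] ℂ)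
  have key : ∀ j, l (v j) = Finsupp.single j (1 : ℂ) i := fun j => by
    have := LinearMap.congr_fun hl ⟨v j, Submodule.subset_span ⟨j, rfl⟩⟩
    simpa [hv.repr_eq_single j ⟨v j, Submodule.subset_span ⟨j, rfl⟩⟩ rfl] using this
  exact ⟨l, by simp [key], fun j hj => by simp [key, hj]⟩

theorem exists_eq_smul_of_mul_comm {X : Type*} {u h : X → ℂ} (h0 : h ≠ 0)
    (H : ∀ x y, u x * h y = h x * u y) : ∃ s : ℂ, ∀ x, u x = s * h x := by
  obtain ⟨z, hz : h z ≠ 0⟩ := Function.ne_iff.1 h0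
  refine ⟨u z / h z, fun x => ?_⟩
  field_simp
  linear_combination H x z

/-- The case where `g` is a multiple of `f`. -/
theorem exists_isClosedSystem_of_smul {k : ℂ} {f h : S → ℂ}
    (hsol : IsSolution f ((k / 2) • f) h) (hfh : LinearIndependent ℂ ![f, h]) :
    ∃ q r s : ℂ, IsClosedSystem q r s f ((k / 2) • f) h := by
  have h0 : h ≠ 0 := hfh.ne_zero 1
  have hf : ∀ x y, f (x * y) = k * f x * f y + h x * h y := fun x y => by
    rw [hsol x y]
    simp only [Pi.smul_apply, smul_eq_mul]
    ring
  obtain ⟨l, hlh, hl⟩ := exists_dual_functional hfh 1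
  have hlf : l f = 0 := hl 0 (by decide)
  replace hlh : l h = 1 := hlh
  obtain ⟨U, hU⟩ : ∃ U : S → ℂ, ∀ x y, h (x * y) = k * f x * h y + h x * U y := by
    refine ⟨fun y => l fun z => h (y * z), fun x y => ?_⟩
    have e : (k * f (x * y)) • f + h (x * y) • h =
        (k * f x) • ((k * f y) • f + h y • h) + h x • fun z => h (y * z) := by
      funext z
      have h₁ := hf (x * y) z
      have h₂ := hf x (y * z)
      rw [mul_assoc, h₂, hf y z] at h₁
      simp only [Pi.smul_apply, Pi.add_apply, smul_eq_mul]
      linear_combination -h₁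
    have := congrArg l e
    simp only [map_add, map_smul, hlf, hlh, smul_eq_mul] at this
    linear_combination this
  -- Inserting the formula for `h (x * y)` back into associativity makes `(U - k f)(y) h(z)`
  -- symmetric in `y` and `z`.
  obtain ⟨s, hs⟩ := exists_eq_smul_of_mul_comm (u := fun y => U y - k * f y) h0 fun y z => by
    obtain ⟨x, hx : h x ≠ 0⟩ := Function.ne_iff.1 h0
    apply mul_left_cancel₀ hx
    have h₁ := hf (x * y) z
    have h₂ := hf x (y * z)
    rw [mul_assoc, h₂, hf y z, hf x y, hU x y, hU y z] at h₁
    linear_combination -h₁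
  refine ⟨0, k / 2, s, hsol, fun x y => ?_, fun x y => ?_⟩
  · simp only [Pi.smul_apply, smul_eq_mul, hf]
    ring
  · simp only [Pi.smul_apply, smul_eq_mul, hU]
    linear_combination h x * hs y

/-- The case where `f`, `g`, `h` are linearly independent. -/
theorem exists_isClosedSystem_of_linearIndependent {f g h : S → ℂ} (hsol : IsSolution f g h)
    (hgfh : LinearIndependent ℂ ![g, f, h]) :
    ∃ q r s : ℂ, IsClosedSystem q r s f g h := by
  have f0 : f ≠ 0 := hgfh.ne_zero 1
  have h0 : h ≠ 0 := hgfh.ne_zero 2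
  obtain ⟨lg, hlgg, hlg⟩ := exists_dual_functional hgfh 0
  obtain ⟨lf, hlff, hlf⟩ := exists_dual_functional hgfh 1
  obtain ⟨lh, hlhh, hlh⟩ := exists_dual_functional hgfh 2
  have hlgf : lg f = 0 := hlg 1 (by decide)
  have hlgh : lg h = 0 := hlg 2 (by decide)
  have hlfg : lf g = 0 := hlf 0 (by decide)
  have hlfh : lf h = 0 := hlf 2 (by decide)
  have hlhg : lh g = 0 := hlh 0 (by decide)
  have hlhf : lh f = 0 := hlh 1 (by decide)
  replace hlgg : lg g = 1 := hlgg
  replace hlff : lf f = 1 := hlff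
  replace hlhh : lh h = 1 := hlhh
  have assoc : ∀ x y z, f (x * y) * g z + g (x * y) * f z + h (x * y) * h z =
      f x * g (y * z) + g x * f (y * z) + h x * h (y * z) := fun x y z => by
    rw [← hsol, ← hsol, mul_assoc]
  have e : ∀ x y, f (x * y) • g + g (x * y) • f + h (x * y) • h =
      f x • (fun z => g (y * z)) + g x • (f y • g + g y • f + h y • h) +
        h x • fun z => h (y * z) := fun x y => by
    funext z
    have := assoc x y z
    rw [hsol y z] at this
    simp only [Pi.smul_apply, Pi.add_apply, smul_eq_mul]
    linear_combination this
  obtain ⟨G₁, H₁, hg⟩ : ∃ G₁ H₁ : S → ℂ, ∀ x y,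
      g (x * y) = f x * G₁ y + g x * g y + h x * H₁ y := by
    refine ⟨fun y => lf fun z => g (y * z), fun y => lf fun z => h (y * z), fun x y => ?_⟩
    have := congrArg lf (e x y)
    simp only [map_add, map_smul, hlff, hlfg, hlfh, smul_eq_mul] at this
    linear_combination this
  obtain ⟨G₂, H₂, hh⟩ : ∃ G₂ H₂ : S → ℂ, ∀ x y,
      h (x * y) = f x * G₂ y + g x * h y + h x * H₂ y := by
    refine ⟨fun y => lh fun z => g (y * z), fun y => lh fun z => h (y * z), fun x y => ?_⟩
    have := congrArg lh (e x y)
    simp only [map_add, map_smul, hlhh, hlhg, hlhf, smul_eq_mul] at this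
    linear_combination this
  -- Associativity is now read as an identity in the left variable `x`; comparing the resulting
  -- right expansions with the left ones pins down `G₁`, `G₂`, `H₁`, `H₂`.
  have e' : ∀ y z,
      (g y * g z + G₁ y * f z + G₂ y * h z) • f +
      (f y * g z + g y * f z + h y * h z) • g +
      (h y * g z + H₁ y * f z + H₂ y * h z) • h =
        g (y * z) • f + f (y * z) • g + h (y * z) • h := fun y z => by
    funext x
    have := assoc x y z
    rw [hsol x y, hg x y, hh x y] at this
    simp only [Pi.smul_apply, Pi.add_apply, smul_eq_mul]
    linear_combination this
  have hg' : ∀ y z, g (y * z) = g y * g z + G₁ y * f z + G₂ y * h z := fun y z => by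
    have := congrArg lf (e' y z)
    simp only [map_add, map_smul, hlff, hlfg, hlfh, smul_eq_mul] at this
    linear_combination -this
  have hh' : ∀ y z, h (y * z) = h y * g z + H₁ y * f z + H₂ y * h z := fun y z => by
    have := congrArg lh (e' y z)
    simp only [map_add, map_smul, hlhh, hlhg, hlhf, smul_eq_mul] at this
    linear_combination -this
  obtain ⟨p, q, hG₁⟩ : ∃ p q : ℂ, ∀ x, G₁ x = p * f x + q * h x := by
    refine ⟨lf G₁, lf H₁, fun x => ?_⟩
    have : f x • G₁ + h x • H₁ = G₁ x • f + G₂ x • h := by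
      funext y
      simp only [Pi.smul_apply, Pi.add_apply, smul_eq_mul]
      linear_combination hg' x y - hg x y
    have := congrArg lf this
    simp only [map_add, map_smul, hlff, hlfh, smul_eq_mul] at this
    linear_combination -this
  have hGH : ∀ x y, (G₂ x - q * f x) * h y = h x * (H₁ y - q * f y) := fun x y => by
    linear_combination hg x y - hg' x y + f x * hG₁ y - f y * hG₁ x
  obtain ⟨r, hH₁, hG₂⟩ : ∃ r : ℂ, (∀ x, H₁ x = q * f x + r * h x) ∧
      ∀ x, G₂ x = q * f x + r * h x := by
    obtain ⟨z, hz : h z ≠ 0⟩ := Function.ne_iff.1 h0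
    have hH : ∀ x, H₁ x = q * f x + (G₂ z - q * f z) / h z * h x := fun x => by
      field_simp
      linear_combination -hGH z x
    refine ⟨_, hH, fun x => ?_⟩
    have h₁ := hGH x z
    have h₂ := hH z
    rw [div_mul_cancel₀ _ hz] at h₂
    field_simp
    linear_combination h₁ + h x * h₂
  obtain ⟨s, hs⟩ := exists_eq_smul_of_mul_comm (u := fun x => H₂ x - r * f x - g x) h0
    fun x y => by
      linear_combination hh x y - hh' x y + f x * hG₂ y - f y * hH₁ x
  have hgm : ∀ x y, g (x * y) = g x * g y + p * (f x * f y) +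
      q * (f x * h y + h x * f y) + r * (h x * h y) := fun x y => by
    linear_combination hg x y + f x * hG₁ y + h x * hH₁ y
  have hhm : ∀ x y, h (x * y) = g x * h y + h x * g y + q * (f x * f y) +
      r * (f x * h y + h x * f y) + s * (h x * h y) := fun x y => by
    linear_combination hh x y + f x * hG₂ y + h x * hs y
  -- Associativity of `h (x * y * z)` leaves `(p - (r² - qs)) f(y) (f(x) h(z) - h(x) f(z)) = 0`.
  have hp : p = r ^ 2 - q * s := by
    rw [← sub_eq_zero]
    refine eq_zero_of_smul_fun f0 fun y => ?_
    have key : ((p - (r ^ 2 - q * s)) * f y) • f = (0 : S → ℂ) := by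
      funext x
      have : (((p - (r ^ 2 - q * s)) * f y * f x) • h -
          ((p - (r ^ 2 - q * s)) * f y * h x) • f : S → ℂ) = 0 := by
        funext z
        have := congrArg h (mul_assoc x y z)
        rw [hhm, hhm x (y * z), hhm x y, hhm y z, hgm x y, hgm y z, hsol x y, hsol y z] at this
        simp only [Pi.smul_apply, Pi.sub_apply, smul_eq_mul, Pi.zero_apply]
        linear_combination this
      have := congrArg lh this
      simpa [hlhh, hlhf] using this
    exact eq_zero_of_smul_fun f0 fun x => congrFun key x
  subst hp
  exact ⟨q, r, s, hsol, hgm, hhm⟩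

theorem isShiftOfFamily_of_isSolution (hS : GeneratedBySquares S) {f g h : S → ℂ}
    (hsol : IsSolution f g h) (hfh : LinearIndependent ℂ ![f, h]) : IsShiftOfFamily f g h := by
  by_cases hg : g ∈ Submodule.span ℂ (Set.range ![f, h])
  · rw [Matrix.range_cons, Matrix.range_cons, Matrix.range_empty, Set.union_empty,
      Set.singleton_union, Submodule.mem_span_pair] at hg
    obtain ⟨a, b, rfl⟩ := hg
    -- This shift removes the `h`-component of `g`.
    apply IsShiftOfFamily.of_shift (-b)
    have hsol' := isSolution_shift hsol (-b)
    have hfh' := linearIndependent_shift hfh (-b)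
    have hk : -((1 / 2 : ℂ) * (-b) ^ 2) • f + (a • f + b • h) + (-b) • h =
        ((2 * a - b ^ 2) / 2) • f := by
      funext x
      simp only [Pi.smul_apply, Pi.add_apply, smul_eq_mul]
      ring
    rw [hk] at hsol' ⊢
    obtain ⟨q, r, s, hsys⟩ := exists_isClosedSystem_of_smul hsol' hfh'
    exact hsys.isShiftOfFamily hS hfh'
  · obtain ⟨q, r, s, hsys⟩ := exists_isClosedSystem_of_linearIndependent hsol
      (linearIndependent_finCons.2 ⟨hfh, hg⟩)
    exact hsys.isShiftOfFamily hS hfh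

end CosineSine

theorem proposition4p2 {S : Type*} [Semigroup S] (hS : CosineSine.GeneratedBySquares S)
    (f g h : S → ℂ) :
    ((∀ x y : S, f (x * y) = f x * g y + g x * f y + h x * h y) ∧
        LinearIndependent ℂ ![f, h]) ↔
      ∃ (δ : ℂ) (F G H : S → ℂ),
        (CosineSine.Family₁ F G H ∨ CosineSine.Family₂ F G H ∨
          CosineSine.Family₃ F G H ∨ CosineSine.Family₄ F G H) ∧
        f = F ∧
        g = -((1 / 2 : ℂ) * δ ^ 2) • F + G + δ • H ∧
        h = -(δ • F) + H := by
  constructor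
  · rintro ⟨hsol, hfh⟩
    exact CosineSine.isShiftOfFamily_of_isSolution hS hsol hfh
  · rintro ⟨δ, F, G, H, hfam, rfl, rfl, rfl⟩
    have key : CosineSine.IsSolution f G H ∧ LinearIndependent ℂ ![f, H] := by
      rcases hfam with hF | hF | hF | hF
      exacts [hF.isSolution, hF.isSolution, hF.isSolution, hF.isSolution]
    exact ⟨CosineSine.isSolution_shift key.1 δ, CosineSine.linearIndependent_shift key.2 δ⟩
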